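/- Let $a,b,c,d\in\mathbb{R}$ with $ac\neq 0$ and $(a,\,b+c,\,d)\neq(1,0,0)$. Define polynomials by $W_0(z)=1$, $W_1(z)=z$ and $W_n(z)=A(z)W_{n-1}(z)+B(z)W_{n-2}(z)$ for $n\ge 2$, where $A(z)=az+b$ and $B(z)=cz+d$. With $\sqrt{\cdot}$ the principal square root ($\sqrt{re^{i\theta}}=\sqrt r\,e^{i\theta/2}$ for $\theta\in(-\pi,\pi]$), put $$\Delta(z)=A(z)^2+4B(z),\quad h(z)=(2-a)z-b,\quad g(z)=(1-a)z^2-(b+c)z-d,$$ $$\lambda_\pm(z)=\frac{A(z)\pm\sqrt{\Delta(z)}}2,\qquad \alpha_\pm(z)=\frac{\sqrt{\Delta(z)}\pm h(z)}{2\sqrt{\Delta(z)}}\ \ (\Delta(z)\ne0).$$ A number $z^*\in\mathbb{C}$ is a limit of zeros if for each $n\ge1$ there is a zero $z_n$ of $W_n$ such that $z_n\to z^*$. A limit of zeros $z$ is called non-isolated if $|\lambda_+(z)|=|\lambda_-(z)|$, and isolated if either $\alpha_-(z)=0$ and $|\lambda_+(z)|<|\lambda_-(z)|$, or $\alpha_+(z)=0$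 and $|\lambda_+(z)|>|\lambda_-(z)|$. Let $$x_A=-\frac ba,\quad x_B=-\frac dc,\quad \Delta_\Delta=c^2-a^2B(x_A),\quad x_\Delta^\pm=x_A+\frac{-2c\pm2\sqrt{\Delta_\Delta}}{a^2},$$ let $C_0=\{z\in\mathbb{C}:|z-x_B|=|x_A-x_B|\}$ and, when $\Delta_\Delta\ge0$, let $J_\Delta=\{x\in\mathbb{R}:x_\Delta^-\le x\le x_\Delta^+\}$. Then every limit of zeros is isolated or non-isolated. The set of isolated limits of zeros is $$\{z\in\mathbb{C}: g(z)=0,\ \operatorname{Re}(A(z)\overline{h(z)})<0\},$$ and the set of non-isolated limits of zeros is - the circular arc connecting $x_\Delta^-$ and $x_\Delta^+$ through $x_A$ (endpoints included), if $\Delta_\Delta<0$; - $C_0$, if $\Delta_\Delta=0$; - $J_\Delta\cup C_0$, if $\Delta_\Delta>0$ and $B(x_A)>0$; - $J_\Delta$, if $\Delta_\Delta>0$ and $B(x_A)\le0$. -/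

import Mathlib

open Filter Topology Polynomial

namespace LinRec

/-- The polynomials `W 0 = 1`, `W 1 = z`, `W n = (a z + b) W (n-1) + (c z + d) W (n-2)`. -/
noncomputable def W (a b c d : ℝ) : ℕ → ℂ[X]
  | 0 => 1
  | 1 => X
  | n + 2 => (C (a : ℂ) * X + C (b : ℂ)) * W a b c d (n + 1)
      + (C (c : ℂ) * X + C (d : ℂ)) * W a b c d n

/-- `w` is a limit of zeros of the sequence `W n`: for each `n ≥ 1` there is a zero of `W n`
such that the chosen zeros converge to `w` (the constant polynomial `W 0 = 1` has no zero). -/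
def IsLimitOfZeros (a b c d : ℝ) (w : ℂ) : Prop :=
  ∃ z : ℕ → ℂ, (∀ n, 1 ≤ n → (W a b c d n).IsRoot (z n)) ∧ Tendsto z atTop (𝓝 w)

/-- `A(z) = a z + b`. -/
def A (a b : ℝ) (z : ℂ) : ℂ := a * z + b

/-- `B(z) = c z + d`. -/
def B (c d : ℝ) (z : ℂ) : ℂ := c * z + d

/-- `Δ(z) = A(z)² + 4 B(z)`. -/
def Delta (a b c d : ℝ) (z : ℂ) : ℂ := A a b z ^ 2 + 4 * B c d z

/-- `h(z) = 2 W₁(z) - A(z) = (2 - a) z - b`. -/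
def h (a b : ℝ) (z : ℂ) : ℂ := (2 - a) * z - b

/-- `g(z) = (1 - a) z² - (b + c) z - d`. -/
def g (a b c d : ℝ) (z : ℂ) : ℂ := (1 - a) * z ^ 2 - (b + c) * z - d

/-- `λ₊(z) = (A(z) + √Δ(z)) / 2`, with the principal square root. -/
noncomputable def lamPlus (a b c d : ℝ) (z : ℂ) : ℂ := (A a b z + Complex.sqrt (Delta a b c d z)) / 2

/-- `λ₋(z) = (A(z) - √Δ(z)) / 2`. -/
noncomputable def lamMinus (a b c d : ℝ) (z : ℂ) : ℂ := (A a b z - Complex.sqrt (Delta a b c d z)) / 2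

/-- `α₊(z) = (√Δ(z) + h(z)) / (2 √Δ(z))`, meaningful where `Δ(z) ≠ 0`. -/
noncomputable def alphaPlus (a b c d : ℝ) (z : ℂ) : ℂ :=
  (Complex.sqrt (Delta a b c d z) + h a b z) / (2 * Complex.sqrt (Delta a b c d z))

/-- `α₋(z) = (√Δ(z) - h(z)) / (2 √Δ(z))`, meaningful where `Δ(z) ≠ 0`. -/
noncomputable def alphaMinus (a b c d : ℝ) (z : ℂ) : ℂ :=
  (Complex.sqrt (Delta a b c d z) - h a b z) / (2 * Complex.sqrt (Delta a b c d z))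

/-- The isolated limits of zeros: the limits of zeros at which the coefficient of the
strictly dominant characteristic root vanishes. (The strict inequalities force `Δ(z) ≠ 0`, so the
value of `α₊`, `α₋` at zeros of `Δ` is irrelevant.) -/
def isolatedLimits (a b c d : ℝ) : Set ℂ :=
  {z | IsLimitOfZeros a b c d z ∧
    ((alphaMinus a b c d z = 0 ∧ ‖lamPlus a b c d z‖ < ‖lamMinus a b c d z‖) ∨
     (alphaPlus a b c d z = 0 ∧ ‖lamMinus a b c d z‖ < ‖lamPlus a b c d z‖))}

/-- The non-isolated limits of zeros: the limits of zeros at which the two characteristic roots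
have the same modulus. -/
def nonIsolatedLimits (a b c d : ℝ) : Set ℂ :=
  {z | IsLimitOfZeros a b c d z ∧ ‖lamPlus a b c d z‖ = ‖lamMinus a b c d z‖}

/-- `x_A = -b / a`, the zero of `A`. -/
noncomputable def xA (a b : ℝ) : ℝ := -b / a

/-- `x_B = -d / c`, the zero of `B`. -/
noncomputable def xB (c d : ℝ) : ℝ := -d / c

/-- The real number `B(x_A)`. -/
noncomputable def BxA (a b c d : ℝ) : ℝ := c * xA a b + d

/-- `Δ_Δ = c² - a² B(x_A)`. -/
noncomputable def DeltaDelta (a b c d : ℝ) : ℝ := c ^ 2 - a ^ 2 * BxA a b c d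

/-- `x_Δ⁺ = x_A + (-2 c + 2 √Δ_Δ) / a²`. -/
noncomputable def xDeltaPlus (a b c d : ℝ) : ℂ :=
  xA a b + (-2 * c + 2 * Complex.sqrt (DeltaDelta a b c d)) / a ^ 2

/-- `x_Δ⁻ = x_A + (-2 c - 2 √Δ_Δ) / a²`. -/
noncomputable def xDeltaMinus (a b c d : ℝ) : ℂ :=
  xA a b + (-2 * c - 2 * Complex.sqrt (DeltaDelta a b c d)) / a ^ 2

/-- The closed circular arc connecting `p` and `r` through `q`, for `p`, `q`, `r` not collinear:
the points of the circle through `p`, `q`, `r` that do not lie strictly on the other side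
of the line `pr` than `q`. -/
def circularArc (p q r : ℂ) : Set ℂ :=
  {z | EuclideanGeometry.Cospherical ({p, q, r, z} : Set ℂ) ∧
    (affineSpan ℝ ({p, r} : Set ℂ)).WSameSide q z}

/-- The circle `C₀` with centre `x_B` and radius `|x_A - x_B|`. -/
noncomputable def C0 (a b c d : ℝ) : Set ℂ :=
  {z | ‖z - (xB c d : ℂ)‖ = |xA a b - xB c d|}

/-- The real interval `J_Δ = [x_Δ⁻, x_Δ⁺]`, as a subset of the complex plane, for `Δ_Δ ≥ 0`
(when `x_Δ⁻` and `x_Δ⁺` are real). -/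
noncomputable def JDelta (a b c d : ℝ) : Set ℂ :=
  {z | ∃ x : ℝ, z = x ∧ (xDeltaMinus a b c d).re ≤ x ∧ x ≤ (xDeltaPlus a b c d).re}

end LinRec

open Filter Topology Polynomial

namespace LinRec

/-! For any square root `s` of `Δ(z)`, `2 ^ (n + 1) * s * W n = (s + h) (A + s) ^ n + (s - h) (A -
s) ^ n`, and `(s + h) (s - h) = -4 g`. The hypothesis `hnd` says exactly that `g` is not identically
zero.

If `A + s` strictly dominates at `w`, division by `(A + s) ^ n` leaves functions converging
uniformly near `w` to `s + h`. By Hurwitz, `w` is a limit of zeros iff `s + h` vanishes there; then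
`s = -h`, which turns dominance into `Re (A * conj h) < 0`.

If the two roots are distinct of equal modulus and `g w ≠ 0`, the zeros solve `q ^ n = r` with `q =
(A - s) / (A + s)` and `r = -(s + h) / (s - h)`. Taking logarithms and dividing by `n` gives `log (q
/ q w) = o(1)` with a suitable branch, and Hurwitz with moving target values produces zeros near
`w`. The remaining equimodular points follow because limits of zeros form a closed set
(`isLimitOfZeros_of_equimodular`).

Equimodularity means `A ^ 2 + t * B = 0` for some `t ∈ [0, 4]` (`norm_sub_eq_norm_add_iff`). In
coordinates centred at `x_A`, eliminating `t` leaves a real interval, the point `x_A`, and the part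
of `C₀` in a half-plane (`exists_quadratic_iff`); the signs of `Δ_Δ` and `B(x_A)` decide what
survives. -/

/-! ### Local complex analysis -/

/-- **Hurwitz's theorem**, for the values `c n` of uniformly convergent holomorphic functions. -/
theorem eventually_exists_eq_of_tendstoUniformlyOn {F : ℂ → ℂ} {f : ℕ → ℂ → ℂ} {c : ℕ → ℂ}
    {z₀ : ℂ} {U V : Set ℂ} (hU : U ∈ 𝓝 z₀) (hV : V ∈ 𝓝 z₀) (hF : AnalyticAt ℂ F z₀)
    (hne : ¬ ∀ᶠ z in 𝓝 z₀, F z = F z₀) (hf : ∀ n, DifferentiableOn ℂ (f n) U)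
    (hlim : TendstoUniformlyOn f F atTop U) (hc : Tendsto c atTop (𝓝 (F z₀))) :
    ∀ᶠ n in atTop, ∃ z ∈ V, f n z = c n := by
  have h1 := (hF.eventually_eq_or_eventually_ne analyticAt_const).resolve_left hne
  have h2 : ∀ᶠ z in 𝓝 z₀, AnalyticAt ℂ F z := (isOpen_analyticAt ℂ F).eventually_mem hF
  obtain ⟨R, hR, hball⟩ := Metric.mem_nhds_iff.1
    (Filter.inter_mem (Filter.inter_mem hU hV) (h2.and (eventually_nhdsWithin_iff.mp h1)))
  have hr : 0 < R / 2 := by positivity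
  have hcl : Metric.closedBall z₀ (R / 2) ⊆ Metric.ball z₀ R :=
    Metric.closedBall_subset_ball (by linarith)
  have hsph : Metric.sphere z₀ (R / 2) ⊆ Metric.ball z₀ R :=
    Metric.sphere_subset_closedBall.trans hcl
  have hcont : ContinuousOn (fun z ↦ ‖F z - F z₀‖) (Metric.sphere z₀ (R / 2)) := fun z hz ↦
    (((hball (hsph hz)).2.1.continuousAt.sub continuousAt_const).norm).continuousWithinAt
  obtain ⟨x, hx, hmin⟩ := (isCompact_sphere z₀ (R / 2)).exists_isMinOn
    (NormedSpace.sphere_nonempty.mpr hr.le) hcont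
  have hm : 0 < ‖F x - F z₀‖ :=
    norm_sub_pos_iff.2 ((hball (hsph hx)).2.2 (ne_of_mem_of_not_mem hx (by simp [hr.ne])))
  set m := ‖F x - F z₀‖
  -- Errors `m / 8` keep `f n` at distance at least `3 m / 4` from `f n z₀` on the sphere and put `c
  -- n` within `m / 4` of `f n z₀`, inside the radius `3 m / 8` given by the quantitative open
  -- mapping theorem.
  filter_upwards [Metric.tendstoUniformlyOn_iff.1 hlim (m / 8) (by positivity),
    Metric.tendsto_nhds.1 hc (m / 8) (by positivity)] with n hn hcn
  have hfR : DifferentiableOn ℂ (f n) (Metric.ball z₀ R) :=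
    (hf n).mono fun z hz ↦ (hball hz).1.1
  have h0 := hn z₀ (hball (Metric.mem_ball_self hR)).1.1
  have hlow : ∀ z ∈ Metric.sphere z₀ (R / 2), 3 * m / 4 ≤ ‖f n z - f n z₀‖ := by
    intro z hz
    have h3 : m ≤ ‖F z - F z₀‖ := hmin hz
    have h4 := hn z (hball (hsph hz)).1.1
    rw [dist_eq_norm] at h4 h0
    have : F z - F z₀ = (F z - f n z) + (f n z - f n z₀) - (F z₀ - f n z₀) := by ring
    have h5 := norm_sub_le ((F z - f n z) + (f n z - f n z₀)) (F z₀ - f n z₀)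
    have h6 := norm_add_le (F z - f n z) (f n z - f n z₀)
    rw [← this] at h5
    linarith
  have hfreq : ∃ᶠ z in 𝓝 z₀, f n z ≠ f n z₀ := by
    intro hev
    have hev' : (f n) =ᶠ[𝓝 z₀] fun _ ↦ f n z₀ := hev.mono fun z hz ↦ not_not.1 hz
    have := (hfR.analyticOnNhd Metric.isOpen_ball).eqOn_of_preconnected_of_eventuallyEq
      analyticOnNhd_const (convex_ball z₀ R).isPreconnected (Metric.mem_ball_self hR) hev'
    have h7 := hlow x hx
    rw [this (hsph hx)] at h7
    simp only [sub_self, norm_zero] at h7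
    linarith
  have hdc : DiffContOnCl ℂ (f n) (Metric.ball z₀ (R / 2)) :=
    ⟨hfR.mono (Metric.ball_subset_ball (by linarith)), by
      rw [closure_ball z₀ hr.ne']; exact hfR.continuousOn.mono hcl⟩
  have hmem : c n ∈ Metric.ball (f n z₀) (3 * m / 4 / 2) := by
    have := dist_triangle (c n) (F z₀) (f n z₀)
    rw [Metric.mem_ball]
    linarith
  obtain ⟨z, hz, hzc⟩ := hdc.ball_subset_image_closedBall hr hlow hfreq hmem
  exact ⟨z, (hball (hcl hz)).1.2, hzc⟩

/-- A holomorphic function has a local logarithm of its ratio to a nonzero value. -/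
theorem exists_analyticAt_log {f : ℂ → ℂ} {z₀ : ℂ} (hf : AnalyticAt ℂ f z₀) (h0 : f z₀ ≠ 0) :
    ∃ L : ℂ → ℂ, AnalyticAt ℂ L z₀ ∧ L z₀ = 0 ∧ ∀ᶠ z in 𝓝 z₀, f z = f z₀ * Complex.exp (L z) := by
  refine ⟨fun z ↦ Complex.log (f z / f z₀), ?_, by simp [h0], ?_⟩
  · refine (hf.div analyticAt_const h0).clog ?_
    simp [h0]
  · filter_upwards [hf.continuousAt.eventually_ne h0] with z hz
    rw [Complex.exp_log (div_ne_zero hz h0)]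
    field_simp

/-- A holomorphic function has a local square root with a prescribed nonzero value. -/
theorem exists_analyticAt_sqrt {f : ℂ → ℂ} {z₀ s₀ : ℂ} (hf : AnalyticAt ℂ f z₀) (hs : s₀ ≠ 0)
    (h0 : s₀ ^ 2 = f z₀) :
    ∃ s : ℂ → ℂ, AnalyticAt ℂ s z₀ ∧ s z₀ = s₀ ∧ ∀ᶠ z in 𝓝 z₀, s z ^ 2 = f z := by
  obtain ⟨L, hL, hL0, hLf⟩ := exists_analyticAt_log hf (h0 ▸ pow_ne_zero 2 hs)
  refine ⟨fun z ↦ s₀ * Complex.exp (L z / 2), ?_, by simp [hL0], ?_⟩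
  · exact analyticAt_const.mul (hL.div analyticAt_const two_ne_zero).cexp
  · filter_upwards [hLf] with z hz
    rw [hz, mul_pow, h0, ← Complex.exp_nat_mul]
    congr 2
    push_cast
    ring

/-- A nonzero quadratic polynomial function has finitely many zeros. -/
theorem finite_setOf_quadratic_eq_zero {p q r : ℂ} (hne : ¬ (p = 0 ∧ q = 0 ∧ r = 0)) :
    {z : ℂ | p * z ^ 2 + q * z + r = 0}.Finite := by
  have hP : (C p * X ^ 2 + C q * X + C r : ℂ[X]) ≠ 0 := by
    intro h
    refine hne ⟨?_, ?_, ?_⟩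
    · simpa [coeff_X, coeff_C] using congrArg (fun P ↦ P.coeff 2) h
    · simpa [coeff_X, coeff_C] using congrArg (fun P ↦ P.coeff 1) h
    · simpa [coeff_X, coeff_C] using congrArg (fun P ↦ P.coeff 0) h
  refine (finite_setOfPred_isRoot hP).subset fun z hz ↦ ?_
  simpa [IsRoot] using hz

theorem quadratic_coeff_eq_zero_of_eventually {p q r z₀ : ℂ}
    (h : ∀ᶠ z in 𝓝 z₀, p * z ^ 2 + q * z + r = 0) : p = 0 ∧ q = 0 ∧ r = 0 := by
  by_contra hne
  exact infinite_of_mem_nhds z₀ h (finite_setOf_quadratic_eq_zero hne)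

/-! ### Closed formula, degrees and the topology of limits of zeros -/

variable {a b c d : ℝ}

theorem eval_W_add_two (n : ℕ) (z : ℂ) : (W a b c d (n + 2)).eval z =
    A a b z * (W a b c d (n + 1)).eval z + B c d z * (W a b c d n).eval z := by
  simp [W, A, B]

/-- The closed formula for `W n`, with an arbitrary square root `s` of `Δ(z)`. -/
theorem two_mul_eval_W {z s : ℂ} (hs : s ^ 2 = Delta a b c d z) (n : ℕ) :
    2 ^ (n + 1) * s * (W a b c d n).eval z =
      (s + h a b z) * (A a b z + s) ^ n + (s - h a b z) * (A a b z - s) ^ n := by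
  induction n using Nat.twoStepInduction with
  | zero => simp [W]; ring
  | one => simp [W, h, A]; ring
  | more n ih₀ ih₁ =>
    rw [eval_W_add_two]
    have hB : 4 * B c d z = s ^ 2 - A a b z ^ 2 := by rw [hs, Delta]; ring
    linear_combination (2 * A a b z) * ih₁ + (s ^ 2 - A a b z ^ 2) * ih₀ +
      2 ^ (n + 1) * s * (W a b c d n).eval z * hB

theorem degree_W (ha : a ≠ 0) (n : ℕ) : (W a b c d n).degree = n := by
  have ha' : (a : ℂ) ≠ 0 := by exact_mod_cast ha
  induction n using Nat.twoStepInduction with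
  | zero => simp [W]
  | one => simp [W]
  | more n ih₀ ih₁ =>
    have h1 : ((C (a : ℂ) * X + C (b : ℂ)) * W a b c d (n + 1)).degree =
        ((n + 2 : ℕ) : WithBot ℕ) := by
      rw [degree_mul, degree_linear ha', ih₁]
      norm_cast
      omega
    have h2 : ((C (c : ℂ) * X + C (d : ℂ)) * W a b c d n).degree < ((n + 2 : ℕ) : WithBot ℕ) := by
      rw [degree_mul, ih₀]
      refine lt_of_le_of_lt (add_le_add_left degree_linear_le _) ?_
      norm_cast
      omega
    rw [← h1]
    exact degree_add_eq_left_of_degree_lt (h2.trans_eq h1.symm)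

theorem exists_isRoot_W (ha : a ≠ 0) {n : ℕ} (hn : 1 ≤ n) : ∃ z, (W a b c d n).IsRoot z := by
  refine Complex.exists_root ?_
  rw [degree_W ha]
  exact_mod_cast hn

/-- Choosing for each `n` a zero nearest to `w` turns the neighbourhood condition into a convergent
sequence. Such a zero exists for every `n ≥ 1` because `W n` has degree `n`. -/
theorem isLimitOfZeros_iff (ha : a ≠ 0) {w : ℂ} : IsLimitOfZeros a b c d w ↔
    ∀ V ∈ 𝓝 w, ∀ᶠ n in atTop, ∃ z ∈ V, (W a b c d n).IsRoot z := by
  constructor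
  · rintro ⟨z, hz, hlim⟩ V hV
    filter_upwards [hlim hV, eventually_ge_atTop 1] with n hn h1
    exact ⟨z n, hn, hz n h1⟩
  · intro H
    have : ∀ n, ∃ z, 1 ≤ n → (W a b c d n).IsRoot z ∧
        ∀ y, (W a b c d n).IsRoot y → dist z w ≤ dist y w := by
      intro n
      by_cases hn : 1 ≤ n
      · have h0 : W a b c d n ≠ 0 := by
          rintro h0
          have := degree_W (b := b) (c := c) (d := d) ha n
          simp [h0] at this
        obtain ⟨z, hz, hmin⟩ := Set.exists_min_image _ (fun z ↦ dist z w)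
          (finite_setOfPred_isRoot h0) (exists_isRoot_W ha hn)
        exact ⟨z, fun _ ↦ ⟨hz, hmin⟩⟩
      · exact ⟨0, fun h ↦ absurd h hn⟩
    choose z hz using this
    refine ⟨z, fun n hn ↦ (hz n hn).1, Metric.tendsto_nhds.2 fun ε hε ↦ ?_⟩
    filter_upwards [H _ (Metric.ball_mem_nhds w hε), eventually_ge_atTop 1] with n hn h1
    obtain ⟨y, hy, hroot⟩ := hn
    exact ((hz n h1).2 y hroot).trans_lt hy

theorem isClosed_setOf_isLimitOfZeros (ha : a ≠ 0) : IsClosed {w | IsLimitOfZeros a b c d w} := by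
  refine isClosed_of_closure_subset fun w hw ↦ (isLimitOfZeros_iff ha).2 fun V hV ↦ ?_
  obtain ⟨y, hyV, hy⟩ := mem_closure_iff_nhds.1 hw _ (interior_mem_nhds.2 hV)
  filter_upwards [(isLimitOfZeros_iff ha).1 hy _ (isOpen_interior.mem_nhds hyV)] with n hn
  obtain ⟨z, hz, hr⟩ := hn
  exact ⟨z, interior_subset hz, hr⟩

theorem analyticAt_A (z : ℂ) : AnalyticAt ℂ (A a b) z := by
  unfold A; fun_prop

theorem analyticAt_h (z : ℂ) : AnalyticAt ℂ (h a b) z := by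
  unfold h; fun_prop

theorem analyticAt_Delta (z : ℂ) : AnalyticAt ℂ (Delta a b c d) z := by
  unfold Delta A B; fun_prop

/-- With `s ^ 2 = Δ` the left side is `(s + h) (s - h)`, so `g` vanishes exactly where a coefficient
of the closed formula does. -/
theorem Delta_sub_h_sq (z : ℂ) : Delta a b c d z - h a b z ^ 2 = -4 * g a b c d z := by
  simp only [Delta, h, g, A, B]; ring

theorem isRoot_W_iff {z s : ℂ} (hs : s ^ 2 = Delta a b c d z) (hs0 : s ≠ 0) (n : ℕ) :
    (W a b c d n).IsRoot z ↔
      (s + h a b z) * (A a b z + s) ^ n + (s - h a b z) * (A a b z - s) ^ n = 0 := by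
  rw [← two_mul_eval_W hs]
  simp [IsRoot, hs0]

theorem finite_setOf_g_eq_zero (hnd : ¬ (a = 1 ∧ b + c = 0 ∧ d = 0)) :
    {z | g a b c d z = 0}.Finite := by
  refine (finite_setOf_quadratic_eq_zero (p := 1 - a) (q := -(b + c)) (r := -d) ?_).subset
    fun z hz ↦ ?_
  · rintro ⟨h1, h2, h3⟩
    refine hnd ⟨?_, ?_, ?_⟩
    · exact_mod_cast (sub_eq_zero.1 h1).symm
    · exact_mod_cast neg_eq_zero.1 h2
    · exact_mod_cast neg_eq_zero.1 h3
  · rw [Set.mem_ofPred_eq] at hz ⊢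
    rw [← hz, g]; ring

theorem not_eventually_g_eq_zero (hnd : ¬ (a = 1 ∧ b + c = 0 ∧ d = 0)) (z₀ : ℂ) :
    ¬ ∀ᶠ z in 𝓝 z₀, g a b c d z = 0 :=
  fun H ↦ infinite_of_mem_nhds z₀ H (finite_setOf_g_eq_zero hnd)

theorem finite_setOf_Delta_eq_zero (ha : a ≠ 0) : {z | Delta a b c d z = 0}.Finite := by
  refine (finite_setOf_quadratic_eq_zero (p := a ^ 2) (q := 2 * a * b + 4 * c)
    (r := b ^ 2 + 4 * d) ?_).subset fun z hz ↦ ?_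
  · rintro ⟨h1, -⟩
    exact ha (by exact_mod_cast pow_eq_zero_iff two_ne_zero |>.1 h1)
  · rw [Set.mem_ofPred_eq] at hz ⊢
    rw [← hz, Delta, A, B]; ring

/-! ### Dominant and equimodular points as limits of zeros -/

/-- At a limit of zeros with a strictly dominant root `(A + s) / 2`, its coefficient vanishes. -/
theorem IsLimitOfZeros.add_h_eq_zero {w s₀ : ℂ} (hw : IsLimitOfZeros a b c d w)
    (hs : s₀ ^ 2 = Delta a b c d w) (hlt : ‖A a b w - s₀‖ < ‖A a b w + s₀‖) :
    s₀ + h a b w = 0 := by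
  have hs0 : s₀ ≠ 0 := by rintro rfl; simp at hlt
  obtain ⟨s, hsan, rfl, hsq⟩ := exists_analyticAt_sqrt (analyticAt_Delta w) hs0 hs
  obtain ⟨z, hz, hlim⟩ := hw
  have hsl := hsan.continuousAt.tendsto.comp hlim
  have hAl := (analyticAt_A (a := a) (b := b) w).continuousAt.tendsto.comp hlim
  have hhl := (analyticAt_h (a := a) (b := b) w).continuousAt.tendsto.comp hlim
  have hne : A a b w + s w ≠ 0 := fun h ↦ by simp [h] at hlt; linarith [norm_nonneg (A a b w - s w)]
  have hql := ((hAl.sub hsl).div (hAl.add hsl) hne).norm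
  have hq1 : ‖(A a b w - s w) / (A a b w + s w)‖ < 1 := by
    rw [norm_div, div_lt_one (norm_pos_iff.2 hne)]
    exact hlt
  obtain ⟨ρ, hρ, hρ1⟩ := exists_between hq1
  have hρ0 : 0 ≤ ρ := (norm_nonneg _).trans hρ.le
  have hpow : Tendsto (fun n ↦ ((A a b (z n) - s (z n)) / (A a b (z n) + s (z n))) ^ n)
      atTop (𝓝 0) := by
    refine squeeze_zero_norm' ?_ (tendsto_pow_atTop_nhds_zero_of_lt_one hρ0 hρ1)
    filter_upwards [hql.eventually_lt_const hρ] with n hn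
    rw [norm_pow]
    exact pow_le_pow_left₀ (norm_nonneg _) hn.le n
  -- The root equation divided by `(A + s) ^ n`: the left side tends to `s w + h w` and is
  -- eventually zero.
  have hsum := (hsl.add hhl).add ((hsl.sub hhl).mul hpow)
  rw [mul_zero, add_zero] at hsum
  refine tendsto_nhds_unique (hsum.congr' ?_) tendsto_const_nhds
  filter_upwards [hlim.eventually hsq, eventually_ge_atTop 1, hsl.eventually_ne hs0,
    (hAl.add hsl).eventually_ne hne] with n hn h1 hn0 hnA
  have := (isRoot_W_iff hn hn0 n).1 (hz n h1)
  simp only [Function.comp_apply] at hnA ⊢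
  rw [div_pow]
  have hp := pow_ne_zero n hnA
  field_simp
  linear_combination this

/-- A point where the coefficient of the strictly dominant root vanishes is a limit of zeros. -/
theorem isLimitOfZeros_of_add_h_eq_zero (ha : a ≠ 0) (hnd : ¬ (a = 1 ∧ b + c = 0 ∧ d = 0))
    {w s₀ : ℂ} (hs : s₀ ^ 2 = Delta a b c d w) (hlt : ‖A a b w - s₀‖ < ‖A a b w + s₀‖)
    (h0 : s₀ + h a b w = 0) : IsLimitOfZeros a b c d w := by
  have hs0 : s₀ ≠ 0 := by rintro rfl; simp at hlt
  obtain ⟨s, hsan, rfl, hsq⟩ := exists_analyticAt_sqrt (analyticAt_Delta w) hs0 hs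
  have hAan := analyticAt_A (a := a) (b := b) w
  have hhan := analyticAt_h (a := a) (b := b) w
  have hne : A a b w + s w ≠ 0 := fun h ↦ by simp [h] at hlt; linarith [norm_nonneg (A a b w - s w)]
  set q : ℂ → ℂ := fun z ↦ (A a b z - s z) / (A a b z + s z) with hq
  have hqan : AnalyticAt ℂ q w := (hAan.sub hsan).div (hAan.add hsan) hne
  have hq1 : ‖q w‖ < 1 := by
    rw [hq, norm_div, div_lt_one (norm_pos_iff.2 hne)]
    exact hlt
  obtain ⟨ρ, hρ, hρ1⟩ := exists_between hq1
  have hρ0 : 0 ≤ ρ := (norm_nonneg _).trans hρ.le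
  set K := ‖s w - h a b w‖ + 1
  set U : Set ℂ := {z | s z ^ 2 = Delta a b c d z ∧ s z ≠ 0 ∧ A a b z + s z ≠ 0 ∧ ‖q z‖ < ρ ∧
    ‖s z - h a b z‖ < K ∧ AnalyticAt ℂ q z ∧ AnalyticAt ℂ s z} with hUdef
  have hU : U ∈ 𝓝 w := by
    filter_upwards [hsq, hsan.continuousAt.eventually_ne hs0,
      (hAan.add hsan).continuousAt.eventually_ne hne,
      hqan.continuousAt.norm.eventually_lt_const hρ,
      (hsan.sub hhan).continuousAt.norm.eventually_lt_const (lt_add_one _),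
      (isOpen_analyticAt ℂ q).eventually_mem hqan,
      (isOpen_analyticAt ℂ s).eventually_mem hsan] with z h1 h2 h3 h4 h5 h6 h7
    exact ⟨h1, h2, h3, h4, h5, h6, h7⟩
  rw [isLimitOfZeros_iff ha]
  intro V hV
  have key := eventually_exists_eq_of_tendstoUniformlyOn (F := fun z ↦ s z + h a b z)
    (f := fun n z ↦ (s z + h a b z) + (s z - h a b z) * q z ^ n) (c := fun _ ↦ 0)
    hU (inter_mem hU hV) (hsan.add hhan) ?_ ?_ ?_ ?_
  · filter_upwards [key] with n hn
    obtain ⟨z, ⟨hzU, hzV⟩, hz⟩ := hn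
    refine ⟨z, hzV, (isRoot_W_iff hzU.1 hzU.2.1 n).2 ?_⟩
    have hp := pow_ne_zero n hzU.2.2.1
    simp only [hq, div_pow] at hz
    field_simp at hz
    linear_combination hz
  -- If `s + h` were locally constant it would vanish near `w`, and so would `g`.
  · intro H
    refine not_eventually_g_eq_zero (a := a) (b := b) (c := c) (d := d) hnd w ?_
    filter_upwards [H, hsq] with z hz hz2
    rw [h0] at hz
    have := Delta_sub_h_sq (a := a) (b := b) (c := c) (d := d) z
    rw [← hz2] at this
    linear_combination this / 4 - (s z - h a b z) / 4 * hz
  · intro n z hz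
    have h1 := hz.2.2.2.2.2.1.differentiableAt
    have h2 := hz.2.2.2.2.2.2.differentiableAt
    have h3 := (analyticAt_h (a := a) (b := b) z).differentiableAt
    exact ((h2.add h3).add ((h2.sub h3).mul (h1.pow n))).differentiableWithinAt
  · rw [Metric.tendstoUniformlyOn_iff]
    intro ε hε
    have ht : Tendsto (fun n ↦ K * ρ ^ n) atTop (𝓝 (K * 0)) :=
      (tendsto_pow_atTop_nhds_zero_of_lt_one hρ0 hρ1).const_mul K
    rw [mul_zero] at ht
    filter_upwards [ht.eventually_lt_const hε] with n hn z hz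
    rw [dist_self_add_right, norm_mul, norm_pow]
    refine lt_of_le_of_lt ?_ hn
    have hz1 := hz.2.2.2.1.le
    have hz2 := hz.2.2.2.2.1.le
    gcongr
  · rw [h0]
    exact tendsto_const_nhds

/-- A point where the two roots are distinct and have the same modulus, and where no coefficient
vanishes, is a limit of zeros. -/
theorem isLimitOfZeros_of_norm_eq (ha : a ≠ 0) {w s₀ : ℂ} (hs : s₀ ^ 2 = Delta a b c d w)
    (hs0 : s₀ ≠ 0) (heq : ‖A a b w - s₀‖ = ‖A a b w + s₀‖) (hg : g a b c d w ≠ 0) :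
    IsLimitOfZeros a b c d w := by
  obtain ⟨s, hsan, rfl, hsq⟩ := exists_analyticAt_sqrt (analyticAt_Delta w) hs0 hs
  have hAan := analyticAt_A (a := a) (b := b) w
  have hhan := analyticAt_h (a := a) (b := b) w
  have hne : A a b w + s w ≠ 0 := by
    intro h
    rw [h, norm_zero, norm_eq_zero] at heq
    exact hs0 (by linear_combination h / 2 - heq / 2)
  have hne' : A a b w - s w ≠ 0 := by
    intro h
    rw [h, norm_zero, eq_comm, norm_eq_zero] at heq
    exact hne heq
  have hprod : (s w + h a b w) * (s w - h a b w) ≠ 0 := by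
    rw [show (s w + h a b w) * (s w - h a b w) = -4 * g a b c d w by
      rw [← Delta_sub_h_sq, ← hs]; ring]
    exact mul_ne_zero (by norm_num) hg
  obtain ⟨hp, hm⟩ := mul_ne_zero_iff.1 hprod
  set q : ℂ → ℂ := fun z ↦ (A a b z - s z) / (A a b z + s z) with hq
  set r : ℂ → ℂ := fun z ↦ -(s z + h a b z) / (s z - h a b z) with hr
  have hqan : AnalyticAt ℂ q w := (hAan.sub hsan).div (hAan.add hsan) hne
  have hran : AnalyticAt ℂ r w := (hsan.add hhan).neg.div (hsan.sub hhan) hm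
  have hq0 : q w ≠ 0 := div_ne_zero hne' hne
  have hr0 : r w ≠ 0 := div_ne_zero (neg_ne_zero.2 hp) hm
  have hq1 : ‖q w‖ = 1 := by
    rw [hq, norm_div, heq, div_self (norm_ne_zero_iff.2 hne)]
  obtain ⟨l, hlan, hl0, hl⟩ := exists_analyticAt_log hqan hq0
  obtain ⟨m, hman, hm0, hmr⟩ := exists_analyticAt_log hran hr0
  set U : Set ℂ := {z | s z ^ 2 = Delta a b c d z ∧ s z ≠ 0 ∧ A a b z + s z ≠ 0 ∧
    s z - h a b z ≠ 0 ∧ q z = q w * Complex.exp (l z) ∧ r z = r w * Complex.exp (m z) ∧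
    ‖m z‖ < 1 ∧ AnalyticAt ℂ l z ∧ AnalyticAt ℂ m z} with hUdef
  have hU : U ∈ 𝓝 w := by
    filter_upwards [hsq, hsan.continuousAt.eventually_ne hs0,
      (hAan.add hsan).continuousAt.eventually_ne hne,
      (hsan.sub hhan).continuousAt.eventually_ne hm, hl, hmr,
      hman.continuousAt.norm.eventually_lt_const (show ‖m w‖ < 1 by simp [hm0]),
      (isOpen_analyticAt ℂ l).eventually_mem hlan,
      (isOpen_analyticAt ℂ m).eventually_mem hman] with z h1 h2 h3 h4 h5 h6 h7 h8 h9
    exact ⟨h1, h2, h3, h4, h5, h6, h7, h8, h9⟩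
  set θ := (q w).arg with hθ
  have hqθ : q w = Complex.exp (θ * Complex.I) := by
    have := Complex.norm_mul_exp_arg_mul_I (q w)
    rw [hq1] at this
    simpa using this.symm
  -- The integer `k n` chooses the branch of the logarithm that keeps `2π k n - n θ` bounded, so
  -- that `c' n` tends to `0 = l w`.
  set k : ℕ → ℤ := fun n ↦ ⌊n * θ / (2 * Real.pi)⌋ with hk
  set c' : ℕ → ℂ := fun n ↦
    (Complex.log (r w) + (2 * Real.pi * k n - n * θ : ℝ) * Complex.I) / n with hc'
  have hkb : ∀ n, |2 * Real.pi * k n - n * θ| ≤ 2 * Real.pi := by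
    intro n
    have h1 := Int.floor_le (n * θ / (2 * Real.pi))
    have h2 := Int.lt_floor_add_one (n * θ / (2 * Real.pi))
    have hpi := Real.two_pi_pos
    rw [le_div_iff₀ hpi] at h1
    rw [div_lt_iff₀ hpi] at h2
    rw [abs_le]
    constructor <;> simp only [hk] <;> linarith
  rw [isLimitOfZeros_iff ha]
  intro V hV
  have key := eventually_exists_eq_of_tendstoUniformlyOn (F := l)
    (f := fun n z ↦ l z - m z / n) (c := c') hU (inter_mem hU hV) hlan ?_ ?_ ?_ ?_
  · filter_upwards [key, eventually_gt_atTop 0] with n hn hn0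
    have hn0' : (n : ℂ) ≠ 0 := by exact_mod_cast hn0.ne'
    obtain ⟨z, ⟨hzU, hzV⟩, hz⟩ := hn
    obtain ⟨h1, h2, h3, h4, h5, h6, -⟩ := hzU
    refine ⟨z, hzV, (isRoot_W_iff h1 h2 n).2 ?_⟩
    have hqr : q z ^ n = r z := by
      rw [h5, h6, hqθ, ← Complex.exp_add, ← Complex.exp_nat_mul]
      have : (n : ℂ) * (θ * Complex.I + l z) =
          Complex.log (r w) + m z + k n * (2 * Real.pi * Complex.I) := by
        simp only [hc'] at hz
        field_simp at hz
        push_cast at hz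
        linear_combination hz
      rw [this, Complex.exp_add, Complex.exp_int_mul_two_pi_mul_I, mul_one, Complex.exp_add,
        Complex.exp_log hr0]
    have hpn := pow_ne_zero n h3
    simp only [hq, hr, div_pow] at hqr
    rw [div_eq_div_iff hpn h4] at hqr
    linear_combination hqr
  -- If `l` were locally constant, so would be `q`; squaring `A (1 - q) = s (1 + q)` gives a
  -- polynomial identity whose leading coefficient `-4 q(w) a ^ 2` is nonzero.
  · intro H
    have H2 : ∀ᶠ z in 𝓝 w, (-4 * q w * a ^ 2) * z ^ 2 +
        (-8 * q w * a * b - 4 * c * (1 + q w) ^ 2) * z +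
        (-4 * q w * b ^ 2 - 4 * d * (1 + q w) ^ 2) = 0 := by
      filter_upwards [H, hU] with z hz hzU
      obtain ⟨h1, h2, h3, h4, h5, -⟩ := hzU
      rw [hz, hl0, Complex.exp_zero, mul_one] at h5
      simp only [hq] at h5
      rw [div_eq_iff h3] at h5
      have e1 : A a b z * (1 - q w) = s z * (1 + q w) := by
        simp only [hq]; linear_combination h5
      have e2 : A a b z ^ 2 * (1 - q w) ^ 2 = Delta a b c d z * (1 + q w) ^ 2 := by
        rw [← h1, ← mul_pow, e1, mul_pow]
      simp only [Delta, A, B] at e2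
      linear_combination e2
    have := (quadratic_coeff_eq_zero_of_eventually H2).1
    simp [hq0, ha] at this
  · intro n z hz
    have h1 := hz.2.2.2.2.2.2.2.1.differentiableAt
    have h2 := hz.2.2.2.2.2.2.2.2.differentiableAt
    exact (h1.sub (h2.div_const _)).differentiableWithinAt
  · rw [Metric.tendstoUniformlyOn_iff]
    intro ε hε
    filter_upwards [(tendsto_const_div_atTop_nhds_zero_nat (1 : ℝ)).eventually_lt_const hε]
      with n hn z hz
    rw [dist_self_sub_right, norm_div, Complex.norm_natCast]
    refine lt_of_le_of_lt ?_ hn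
    have := hz.2.2.2.2.2.2.1.le
    gcongr
  · rw [hl0]
    refine squeeze_zero_norm (fun n ↦ ?_) (tendsto_const_div_atTop_nhds_zero_nat
      (‖Complex.log (r w)‖ + 2 * Real.pi))
    simp only [hc']
    rw [norm_div, Complex.norm_natCast]
    gcongr
    refine (norm_add_le _ _).trans ?_
    rw [norm_mul, Complex.norm_I, mul_one, Complex.norm_real]
    gcongr
    exact hkb n

/-! ### Equimodular points as zeros of `A ^ 2 + t B` -/

theorem sqrt_sq (z : ℂ) : Complex.sqrt z ^ 2 = z := by
  simp [Complex.sqrt]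

theorem norm_one_sub_eq_norm_one_add_iff {w : ℂ} : ‖1 - w‖ = ‖1 + w‖ ↔ w.re = 0 := by
  rw [← sq_eq_sq₀ (norm_nonneg _) (norm_nonneg _), Complex.sq_norm, Complex.sq_norm,
    Complex.normSq_apply, Complex.normSq_apply]
  simp only [Complex.sub_re, Complex.add_re, Complex.sub_im, Complex.add_im, Complex.one_re,
    Complex.one_im]
  constructor
  · intro h; linarith
  · intro h; rw [h]; ring

/-- The two roots of `X ^ 2 - u X - v` have the same modulus iff `u ^ 2 + t v = 0` for some
`t ∈ [0, 4]`. -/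
theorem norm_sub_eq_norm_add_iff {u v s : ℂ} (hs : s ^ 2 = u ^ 2 + 4 * v) :
    ‖u - s‖ = ‖u + s‖ ↔ ∃ t : ℝ, t ∈ Set.Icc 0 4 ∧ u ^ 2 + t * v = 0 := by
  rcases eq_or_ne u 0 with rfl | hu
  · simp only [zero_sub, norm_neg, zero_add, true_iff]
    exact ⟨0, by norm_num, by simp⟩
  have e1 : u - s = u * (1 - s / u) := by field_simp
  have e2 : u + s = u * (1 + s / u) := by field_simp
  rw [e1, e2, norm_mul, norm_mul, mul_right_inj' (norm_ne_zero_iff.2 hu),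
    norm_one_sub_eq_norm_one_add_iff]
  have hw : (s / u) ^ 2 * u ^ 2 = u ^ 2 + 4 * v := by rw [div_pow]; field_simp; exact hs
  generalize s / u = w at hw
  constructor
  · intro hre
    have hw2 : w ^ 2 = ((-w.im ^ 2 : ℝ) : ℂ) := by
      apply Complex.ext
      · rw [Complex.ofReal_re, sq, Complex.mul_re, hre]; ring
      · rw [Complex.ofReal_im, sq, Complex.mul_im, hre]; ring
    have hpos : (0 : ℝ) < 1 + w.im ^ 2 := by positivity
    -- For `w = s / u`, the relation `(1 - w ^ 2) u ^ 2 + 4 v = 0` gives `t = 4 / (1 - w ^ 2)`, and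
    -- `w ^ 2 = -w.im ^ 2`.
    refine ⟨4 / (1 + w.im ^ 2), ⟨by positivity, ?_⟩, ?_⟩
    · rw [div_le_iff₀ hpos]; nlinarith [sq_nonneg w.im]
    · rw [hw2] at hw
      have hne : (1 + (w.im : ℂ) ^ 2) ≠ 0 := by exact_mod_cast hpos.ne'
      push_cast at hw ⊢
      field_simp
      linear_combination -hw
  · rintro ⟨t, ⟨ht0, ht4⟩, ht⟩
    have htne : t ≠ 0 := by
      rintro rfl
      simp [hu] at ht
    have htpos : 0 < t := lt_of_le_of_ne ht0 htne.symm
    have hw2 : t * w ^ 2 = ((t - 4 : ℝ) : ℂ) := by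
      have : u ^ 2 * (t * w ^ 2 - (t - 4)) = 0 := by linear_combination t * hw + 4 * ht
      have := (mul_eq_zero.1 this).resolve_left (pow_ne_zero 2 hu)
      push_cast
      linear_combination this
    have hre := congrArg Complex.re hw2
    have him := congrArg Complex.im hw2
    rw [Complex.ofReal_re, Complex.re_ofReal_mul, sq, Complex.mul_re] at hre
    rw [Complex.ofReal_im, Complex.im_ofReal_mul, sq, Complex.mul_im] at him
    have h2 : w.re * w.im = 0 := by
      rcases mul_eq_zero.1 him with h | h
      · exact absurd h htne
      · linarith
    rcases mul_eq_zero.1 h2 with h | h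
    · exact h
    · rw [h] at hre
      have : t * (w.re * w.re) ≤ 0 := by linarith
      have h3 : w.re * w.re ≤ 0 := by
        by_contra hcon
        push Not at hcon
        linarith [mul_pos htpos hcon]
      exact mul_self_eq_zero.1 (le_antisymm h3 (mul_self_nonneg _))

theorem A_eq (ha : a ≠ 0) (z : ℂ) : A a b z = a * (z - xA a b) := by
  have : (a : ℂ) ≠ 0 := by exact_mod_cast ha
  simp only [A, xA]
  push_cast
  field_simp
  ring

theorem B_eq (z : ℂ) : B c d z = c * (z - xA a b) + BxA a b c d := by
  simp only [B, BxA]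
  push_cast
  ring

/-- Continuity in `t` of the zeros of `A ^ 2 + t B`, staying away from the zero of `B`. -/
theorem exists_near_root (ha : a ≠ 0) (hc : c ≠ 0) {z₀ : ℂ} {t₀ : ℝ} (ht₀ : t₀ ∈ Set.Icc (0 : ℝ) 4)
    (hz₀ : A a b z₀ ^ 2 + t₀ * B c d z₀ = 0) {ε : ℝ} (hε : 0 < ε) :
    ∃ t₁ ∈ Set.Icc (0 : ℝ) 4, ∃ δ > 0, ∀ t : ℝ, 0 < t → |t - t₁| < δ →
      ∃ z, dist z z₀ < ε ∧ A a b z ^ 2 + t * B c d z = 0 ∧ B c d z ≠ 0 := by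
  have ha' : (a : ℂ) ≠ 0 := by exact_mod_cast ha
  have hc' : (c : ℂ) ≠ 0 := by exact_mod_cast hc
  -- If `B(x_A) = 0`, the equation factors and `x_A` is a root for every `t`; to approach it with `B
  -- ≠ 0` one follows the other root as `t → 0`, hence `t₁` may differ from `t₀`. Otherwise `A` and
  -- `B` have no common zero, and the product of the distances from `z₀` to the two roots is `|t -
  -- t₀| ‖B z₀‖ / a ^ 2`.
  by_cases hβ : BxA a b c d = 0
  · have hB : ∀ z, B c d z = c * (z - xA a b) := fun z ↦ by rw [B_eq (a := a) (b := b), hβ]; simp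
    obtain ⟨t₁, ht₁, hzt⟩ : ∃ t₁ ∈ Set.Icc (0 : ℝ) 4, z₀ = xA a b - t₁ * c / a ^ 2 := by
      rw [A_eq ha, hB] at hz₀
      have : (z₀ - xA a b) * (a ^ 2 * (z₀ - xA a b) + t₀ * c) = 0 := by linear_combination hz₀
      rcases mul_eq_zero.1 this with h | h
      · exact ⟨0, by norm_num, by simpa using sub_eq_zero.1 h⟩
      · refine ⟨t₀, ht₀, ?_⟩
        field_simp
        linear_combination h
    have hcont : Continuous fun t : ℝ ↦ (xA a b - t * c / a ^ 2 : ℂ) := by fun_prop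
    obtain ⟨δ, hδ, H⟩ := Metric.continuous_iff.1 hcont t₁ ε hε
    refine ⟨t₁, ht₁, δ, hδ, fun t ht htδ ↦ ⟨xA a b - t * c / a ^ 2, ?_, ?_, ?_⟩⟩
    · rw [hzt]; exact H t htδ
    · rw [A_eq ha, hB]; field_simp; ring
    · have : (t : ℂ) ≠ 0 := by exact_mod_cast ht.ne'
      rw [hB]
      simp [ha', hc', this]
  · refine ⟨t₀, ht₀, a ^ 2 * ε ^ 2 / (‖B c d z₀‖ + 1), by positivity, fun t ht htδ ↦ ?_⟩
    have hBne : ∀ z, A a b z ^ 2 + t * B c d z = 0 → B c d z ≠ 0 := by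
      intro z hz h0
      rw [h0, mul_zero, add_zero] at hz
      have := pow_eq_zero_iff two_ne_zero |>.1 hz
      rw [A_eq ha, mul_eq_zero, or_iff_right ha'] at this
      rw [B_eq (a := a) (b := b), this] at h0
      exact hβ (by simpa using h0)
    obtain ⟨s, hs⟩ : ∃ s : ℂ, s ^ 2 = (2 * a * b + t * c) ^ 2 - 4 * a ^ 2 * (b ^ 2 + t * d) :=
      ⟨_, sqrt_sq _⟩
    set r₁ : ℂ := (-(2 * a * b + t * c) + s) / (2 * a ^ 2) with hr₁
    set r₂ : ℂ := (-(2 * a * b + t * c) - s) / (2 * a ^ 2) with hr₂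
    have hfac : ∀ z, A a b z ^ 2 + t * B c d z = a ^ 2 * ((z - r₁) * (z - r₂)) := by
      intro z
      simp only [A, B, hr₁, hr₂]
      field_simp
      linear_combination hs
    have hmul : a ^ 2 * (dist r₁ z₀ * dist r₂ z₀) = |t - t₀| * ‖B c d z₀‖ := by
      have h1 : A a b z₀ ^ 2 + t * B c d z₀ = ((t - t₀ : ℝ) : ℂ) * B c d z₀ := by
        push_cast; linear_combination hz₀
      rw [hfac] at h1
      have := congrArg norm h1
      rw [norm_mul, norm_mul, norm_mul, Complex.norm_real, norm_pow, Complex.norm_real] at this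
      rw [dist_comm, dist_comm r₂, dist_eq_norm, dist_eq_norm]
      simpa using this
    have hlt : |t - t₀| * ‖B c d z₀‖ < a ^ 2 * ε ^ 2 := by
      rw [lt_div_iff₀ (by positivity)] at htδ
      nlinarith [abs_nonneg (t - t₀)]
    have : dist r₁ z₀ < ε ∨ dist r₂ z₀ < ε := by
      by_contra hcon
      push Not at hcon
      have h1 : ε * ε ≤ dist r₁ z₀ * dist r₂ z₀ := mul_le_mul hcon.1 hcon.2 hε.le dist_nonneg
      have h2 : a ^ 2 * (ε * ε) ≤ a ^ 2 * (dist r₁ z₀ * dist r₂ z₀) := by gcongr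
      nlinarith
    rcases this with h | h
    · have h0 : A a b r₁ ^ 2 + t * B c d r₁ = 0 := by rw [hfac]; ring
      exact ⟨r₁, h, h0, hBne _ h0⟩
    · have h0 : A a b r₂ ^ 2 + t * B c d r₂ = 0 := by rw [hfac]; ring
      exact ⟨r₂, h, h0, hBne _ h0⟩

/-- Since `B ≠ 0` recovers `t` from the root, nearby parameters give infinitely many equimodular
points near `z₀`. Only finitely many satisfy `g = 0` or `Δ = 0`; the others are limits of zeros, and
closedness gives `z₀`. -/
theorem isLimitOfZeros_of_equimodular (ha : a ≠ 0) (hc : c ≠ 0)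
    (hnd : ¬ (a = 1 ∧ b + c = 0 ∧ d = 0)) {z₀ : ℂ} {t₀ : ℝ} (ht₀ : t₀ ∈ Set.Icc (0 : ℝ) 4)
    (hz₀ : A a b z₀ ^ 2 + t₀ * B c d z₀ = 0) : IsLimitOfZeros a b c d z₀ := by
  refine (isClosed_setOf_isLimitOfZeros (b := b) (c := c) (d := d) ha).closure_subset
    (Metric.mem_closure_iff.2 fun ε hε ↦ ?_)
  obtain ⟨t₁, ht₁, δ, hδ, H⟩ := exists_near_root ha hc ht₀ hz₀ hε
  have H' : ∀ t : ℝ, ∃ z, (0 < t ∧ |t - t₁| < δ) →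
      dist z z₀ < ε ∧ A a b z ^ 2 + t * B c d z = 0 ∧ B c d z ≠ 0 := by
    intro t
    by_cases h : 0 < t ∧ |t - t₁| < δ
    · obtain ⟨z, hz⟩ := H t h.1 h.2
      exact ⟨z, fun _ ↦ hz⟩
    · exact ⟨0, fun h' ↦ absurd h' h⟩
  choose z hz using H'
  set T := Set.Ioo (max 0 (t₁ - δ)) (min 4 (t₁ + δ)) with hT
  have hTinf : T.Infinite := by
    refine Set.Ioo_infinite (max_lt (lt_min (by norm_num) ?_) (lt_min ?_ ?_)) <;>
      linarith [ht₁.1, ht₁.2]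
  have hTz : ∀ t ∈ T, 0 < t ∧ |t - t₁| < δ := by
    rintro t ⟨h1, h2⟩
    obtain ⟨h1, h3⟩ := max_lt_iff.1 h1
    obtain ⟨h2, h4⟩ := lt_min_iff.1 h2
    exact ⟨h1, abs_lt.2 ⟨by linarith, by linarith⟩⟩
  have hinj : Set.InjOn z T := by
    intro t ht t' ht' heq
    obtain ⟨-, h1, h2⟩ := hz t (hTz t ht)
    obtain ⟨-, h3, -⟩ := hz t' (hTz t' ht')
    rw [← heq] at h3
    have : ((t : ℂ) - t') * B c d (z t) = 0 := by linear_combination h1 - h3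
    have := (mul_eq_zero.1 this).resolve_right h2
    exact_mod_cast sub_eq_zero.1 this
  obtain ⟨y, ⟨t, ht, rfl⟩, hy⟩ := ((hTinf.image hinj).sdiff
    ((finite_setOf_g_eq_zero hnd).union
      (finite_setOf_Delta_eq_zero (b := b) (c := c) (d := d) ha))).nonempty
  simp only [Set.mem_union, Set.mem_ofPred_eq, not_or] at hy
  obtain ⟨h1, h2, -⟩ := hz t (hTz t ht)
  refine ⟨z t, ?_, by rwa [dist_comm]⟩
  obtain ⟨s, hs⟩ : ∃ s, s ^ 2 = Delta a b c d (z t) := ⟨_, sqrt_sq _⟩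
  have hs0 : s ≠ 0 := by
    rintro rfl
    exact hy.2 (by simpa using hs.symm)
  have htT : t ∈ Set.Icc (0 : ℝ) 4 := ⟨(hTz t ht).1.le, (ht.2.trans_le (min_le_left _ _)).le⟩
  exact isLimitOfZeros_of_norm_eq ha hs hs0
    ((norm_sub_eq_norm_add_iff hs).2 ⟨t, htT, h2⟩) hy.1

/-! ### The isolated and non-isolated sets -/

theorem norm_lamPlus (z : ℂ) :
    ‖lamPlus a b c d z‖ = ‖A a b z + Complex.sqrt (Delta a b c d z)‖ / 2 := by
  simp [lamPlus]

theorem norm_lamMinus (z : ℂ) :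
    ‖lamMinus a b c d z‖ = ‖A a b z - Complex.sqrt (Delta a b c d z)‖ / 2 := by
  simp [lamMinus]

theorem nonIsolatedLimits_eq (ha : a ≠ 0) (hc : c ≠ 0) (hnd : ¬ (a = 1 ∧ b + c = 0 ∧ d = 0)) :
    nonIsolatedLimits a b c d =
      {z | ∃ t : ℝ, t ∈ Set.Icc 0 4 ∧ A a b z ^ 2 + t * B c d z = 0} := by
  ext z
  have h := norm_sub_eq_norm_add_iff (u := A a b z) (v := B c d z) (sqrt_sq (Delta a b c d z))
  rw [nonIsolatedLimits, Set.mem_ofPred_eq, Set.mem_ofPred_eq, ← h, norm_lamPlus,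
    norm_lamMinus, div_left_inj' two_ne_zero, eq_comm (a := ‖A a b z + _‖)]
  refine and_iff_right_of_imp fun heq ↦ ?_
  obtain ⟨t, ht, hz⟩ := h.1 heq
  exact isLimitOfZeros_of_equimodular ha hc hnd ht hz

theorem alphaPlus_eq_zero_iff {z : ℂ} (h0 : Complex.sqrt (Delta a b c d z) ≠ 0) :
    alphaPlus a b c d z = 0 ↔ Complex.sqrt (Delta a b c d z) + h a b z = 0 := by
  simp [alphaPlus, h0]

theorem alphaMinus_eq_zero_iff {z : ℂ} (h0 : Complex.sqrt (Delta a b c d z) ≠ 0) :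
    alphaMinus a b c d z = 0 ↔ -Complex.sqrt (Delta a b c d z) + h a b z = 0 := by
  simp only [alphaMinus, div_eq_zero_iff, mul_eq_zero, h0, OfNat.ofNat_ne_zero, or_false]
  rw [← neg_eq_zero, neg_sub, sub_eq_add_neg, add_comm]

/-- The two alternatives of the definition are the two signs of the square root; `s` is the one
making `(A + s) / 2` dominant. -/
theorem mem_isolatedLimits_iff {z : ℂ} : z ∈ isolatedLimits a b c d ↔
    IsLimitOfZeros a b c d z ∧ ∃ s, s ^ 2 = Delta a b c d z ∧ s + h a b z = 0 ∧
      ‖A a b z - s‖ < ‖A a b z + s‖ := by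
  rw [isolatedLimits, Set.mem_ofPred_eq, norm_lamPlus, norm_lamMinus,
    div_lt_div_iff_of_pos_right two_pos, div_lt_div_iff_of_pos_right two_pos]
  have hsq := sqrt_sq (Delta a b c d z)
  refine and_congr_right fun _ ↦ ?_
  set r := Complex.sqrt (Delta a b c d z) with hr
  constructor
  · rintro (⟨h1, h2⟩ | ⟨h1, h2⟩)
    · have h0 : r ≠ 0 := by rintro h0; simp [h0] at h2
      exact ⟨-r, by rw [neg_sq, hsq], (alphaMinus_eq_zero_iff h0).1 h1,
        by rwa [sub_neg_eq_add, ← sub_eq_add_neg]⟩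
    · have h0 : r ≠ 0 := by rintro h0; simp [h0] at h2
      exact ⟨r, hsq, (alphaPlus_eq_zero_iff h0).1 h1, h2⟩
  · rintro ⟨s, hs, h1, h2⟩
    have h0 : s ≠ 0 := by rintro rfl; simp at h2
    rcases sq_eq_sq_iff_eq_or_eq_neg.1 (hs.trans hsq.symm) with rfl | rfl
    · exact Or.inr ⟨(alphaPlus_eq_zero_iff h0).2 h1, h2⟩
    · exact Or.inl ⟨(alphaMinus_eq_zero_iff (neg_ne_zero.1 h0)).2 h1,
        by rwa [sub_neg_eq_add, ← sub_eq_add_neg] at h2⟩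

theorem norm_add_lt_norm_sub_iff {u v : ℂ} :
    ‖u + v‖ < ‖u - v‖ ↔ (u * (starRingEnd ℂ) v).re < 0 := by
  rw [← sq_lt_sq₀ (norm_nonneg _) (norm_nonneg _), Complex.sq_norm, Complex.sq_norm,
    Complex.normSq_add, Complex.normSq_sub]
  constructor <;> intro h <;> linarith

theorem isolatedLimits_eq (ha : a ≠ 0) (hnd : ¬ (a = 1 ∧ b + c = 0 ∧ d = 0)) :
    isolatedLimits a b c d =
      {z | g a b c d z = 0 ∧ (A a b z * (starRingEnd ℂ) (h a b z)).re < 0} := by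
  ext z
  rw [mem_isolatedLimits_iff, Set.mem_ofPred_eq, ← norm_add_lt_norm_sub_iff]
  have hD := Delta_sub_h_sq (a := a) (b := b) (c := c) (d := d) z
  constructor
  · rintro ⟨-, s, hs, h1, h2⟩
    obtain rfl : s = -h a b z := eq_neg_of_add_eq_zero_left h1
    refine ⟨?_, by rwa [sub_neg_eq_add, ← sub_eq_add_neg] at h2⟩
    linear_combination hD / 4 + hs / 4
  · rintro ⟨hg, h2⟩
    have hs : (-h a b z) ^ 2 = Delta a b c d z := by
      rw [hg] at hD
      linear_combination -hD
    have h3 : ‖A a b z - -h a b z‖ < ‖A a b z + -h a b z‖ := by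
      rwa [sub_neg_eq_add, ← sub_eq_add_neg]
    exact ⟨isLimitOfZeros_of_add_h_eq_zero ha hnd hs h3 (neg_add_cancel _), _, hs,
      neg_add_cancel _, h3⟩

theorem IsLimitOfZeros.isolated_or_nonIsolated {z : ℂ} (hz : IsLimitOfZeros a b c d z) :
    z ∈ isolatedLimits a b c d ∨ z ∈ nonIsolatedLimits a b c d := by
  have hsq := sqrt_sq (Delta a b c d z)
  rw [mem_isolatedLimits_iff, nonIsolatedLimits, Set.mem_ofPred_eq, norm_lamPlus,
    norm_lamMinus, div_left_inj' two_ne_zero]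
  rcases lt_trichotomy ‖A a b z + Complex.sqrt (Delta a b c d z)‖
    ‖A a b z - Complex.sqrt (Delta a b c d z)‖ with h | h | h
  · have hs : (-Complex.sqrt (Delta a b c d z)) ^ 2 = Delta a b c d z := by rw [neg_sq, hsq]
    have h' : ‖A a b z - -Complex.sqrt (Delta a b c d z)‖ <
        ‖A a b z + -Complex.sqrt (Delta a b c d z)‖ := by
      rwa [sub_neg_eq_add, ← sub_eq_add_neg]
    exact Or.inl ⟨hz, _, hs, hz.add_h_eq_zero hs h', h'⟩
  · exact Or.inr ⟨hz, h⟩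
  · exact Or.inl ⟨hz, _, hsq, hz.add_h_eq_zero hsq h, h⟩

/-! ### Real equations of the interval, the circle and the arc -/

/-- The real equations of the set of `x + i y` with `a² (x + i y)² + t (c (x + i y) + β) = 0` for
some `t ∈ [0, 4]`. -/
theorem exists_quadratic_iff {β x y : ℝ} (ha : a ≠ 0) (hc : c ≠ 0) :
    (∃ t : ℝ, t ∈ Set.Icc 0 4 ∧ a ^ 2 * (x ^ 2 - y ^ 2) + t * (c * x + β) = 0 ∧
      2 * a ^ 2 * x * y + t * c * y = 0) ↔
    (y = 0 ∧ (x = 0 ∨ (a ^ 2 * x + 2 * c) ^ 2 ≤ 4 * (c ^ 2 - a ^ 2 * β))) ∨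
    (c * (x ^ 2 + y ^ 2) + 2 * x * β = 0 ∧ 0 ≤ -(c * x) ∧ a ^ 2 * -(c * x) ≤ 2 * c ^ 2) := by
  have ha2 : 0 < a ^ 2 := by positivity
  have hc2 : 0 < c ^ 2 := by positivity
  constructor
  · rintro ⟨t, ⟨ht0, ht4⟩, h1, h2⟩
    rcases eq_or_ne y 0 with rfl | hy
    · refine Or.inl ⟨rfl, or_iff_not_imp_left.2 fun hx ↦ ?_⟩
      have hx2 : 0 < a ^ 2 * x ^ 2 := by positivity
      have hneg : c * x + β < 0 := by
        by_contra hcon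
        push Not at hcon
        have := mul_nonneg ht0 hcon
        linarith
      have : a ^ 2 * x ^ 2 + 4 * (c * x + β) ≤ 0 := by nlinarith
      nlinarith
    · right
      -- Off the real axis the imaginary part determines `t = 2 a ^ 2 (-c x) / c ^ 2`; the real part
      -- becomes the circle and `t ∈ [0, 4]` the two inequalities.
      have h3 : 2 * a ^ 2 * x + t * c = 0 := by
        have : (2 * a ^ 2 * x + t * c) * y = 0 := by linear_combination h2
        exact (mul_eq_zero.1 this).resolve_right hy
      have h4 : a ^ 2 * -(c * x) * 2 = t * c ^ 2 := by linear_combination -c * h3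
      refine ⟨?_, ?_, ?_⟩
      · have : a ^ 2 * (c * (x ^ 2 + y ^ 2) + 2 * x * β) = 0 := by
          linear_combination -c * h1 + (c * x + β) * h3
        exact (mul_eq_zero.1 this).resolve_left ha2.ne'
      · have := mul_nonneg ht0 hc2.le
        by_contra hcon
        push Not at hcon
        nlinarith
      · nlinarith
  · rintro (⟨rfl, rfl | h⟩ | ⟨h1, h2, h3⟩)
    · exact ⟨0, by norm_num, by simp, by simp⟩
    · rcases eq_or_ne x 0 with rfl | hx
      · exact ⟨0, by norm_num, by simp, by simp⟩
      have hx2 : 0 < a ^ 2 * x ^ 2 := by positivity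
      have h5 : a ^ 2 * x ^ 2 ≤ 4 * -(c * x + β) := by
        by_contra hcon
        push Not at hcon
        have := mul_pos ha2 (sub_pos.2 hcon)
        nlinarith
      have hpos : 0 < -(c * x + β) := by linarith
      refine ⟨a ^ 2 * x ^ 2 / -(c * x + β), ⟨by positivity, (div_le_iff₀ hpos).2 h5⟩, ?_, by simp⟩
      have h6 : c * x + β ≠ 0 := neg_ne_zero.1 hpos.ne'
      rw [div_neg, neg_mul, div_mul_cancel₀ _ h6]
      ring
    · refine ⟨2 * (a ^ 2 * -(c * x)) / c ^ 2, ⟨by positivity, ?_⟩, ?_, ?_⟩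
      · rw [div_le_iff₀ hc2]; linarith
      · field_simp
        linear_combination -a ^ 2 * h1
      · field_simp
        ring

theorem mem_nonIsolatedLimits_iff (ha : a ≠ 0) (hc : c ≠ 0) (hnd : ¬ (a = 1 ∧ b + c = 0 ∧ d = 0))
    (x y : ℝ) : (xA a b + (x + y * Complex.I) : ℂ) ∈ nonIsolatedLimits a b c d ↔
    (y = 0 ∧ (x = 0 ∨ (a ^ 2 * x + 2 * c) ^ 2 ≤ 4 * DeltaDelta a b c d)) ∨
    (c * (x ^ 2 + y ^ 2) + 2 * x * BxA a b c d = 0 ∧ 0 ≤ -(c * x) ∧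
      a ^ 2 * -(c * x) ≤ 2 * c ^ 2) := by
  rw [nonIsolatedLimits_eq ha hc hnd, DeltaDelta, ← exists_quadratic_iff ha hc]
  refine exists_congr fun t ↦ and_congr_right fun _ ↦ ?_
  rw [A_eq ha, B_eq (a := a) (b := b), add_sub_cancel_left]
  have : ((a : ℂ) * (x + y * Complex.I)) ^ 2 + t * (c * (x + y * Complex.I) + BxA a b c d) =
      ((a ^ 2 * (x ^ 2 - y ^ 2) + t * (c * x + BxA a b c d) : ℝ) : ℂ) +
      ((2 * a ^ 2 * x * y + t * c * y : ℝ) : ℂ) * Complex.I := by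
    push_cast
    linear_combination (a : ℂ) ^ 2 * y ^ 2 * Complex.I_sq
  rw [this, Complex.ext_iff]
  simp only [Complex.add_re, Complex.add_im, Complex.ofReal_re, Complex.ofReal_im,
    Complex.re_ofReal_mul, Complex.im_ofReal_mul, Complex.I_re, Complex.I_im, Complex.zero_re,
    Complex.zero_im, mul_zero, mul_one, add_zero, zero_add]

theorem mem_C0_iff (hc : c ≠ 0) (x y : ℝ) :
    (xA a b + (x + y * Complex.I) : ℂ) ∈ C0 a b c d ↔
      c * (x ^ 2 + y ^ 2) + 2 * x * BxA a b c d = 0 := by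
  have h1 : xA a b - xB c d = BxA a b c d / c := by
    simp only [BxA, xB]; field_simp; ring
  have h2 : (xA a b + (x + y * Complex.I) : ℂ) - xB c d =
      ((x + BxA a b c d / c : ℝ) : ℂ) + (y : ℝ) * Complex.I := by
    rw [← h1]; push_cast; ring
  rw [C0, Set.mem_ofPred_eq, h2, h1, ← sq_eq_sq₀ (norm_nonneg _) (abs_nonneg _), Complex.sq_norm,
    Complex.normSq_add_mul_I, sq_abs]
  constructor
  · intro h
    field_simp at h
    have : c * (c * (x ^ 2 + y ^ 2) + 2 * x * BxA a b c d) = 0 := by linear_combination h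
    exact (mul_eq_zero.1 this).resolve_left hc
  · intro h
    field_simp
    linear_combination c * h

theorem mem_JDelta_iff (ha : a ≠ 0) (hD : 0 ≤ DeltaDelta a b c d) (x y : ℝ) :
    (xA a b + (x + y * Complex.I) : ℂ) ∈ JDelta a b c d ↔
      y = 0 ∧ (a ^ 2 * x + 2 * c) ^ 2 ≤ 4 * DeltaDelta a b c d := by
  have hs : Complex.sqrt (DeltaDelta a b c d) = (√(DeltaDelta a b c d) : ℝ) := by
    rw [Complex.sqrt_of_nonneg (by exact_mod_cast hD), Complex.ofReal_re]
  have hp : xDeltaPlus a b c d =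
      ((xA a b + (-2 * c + 2 * √(DeltaDelta a b c d)) / a ^ 2 : ℝ) : ℂ) := by
    rw [xDeltaPlus, hs]; push_cast; ring
  have hm : xDeltaMinus a b c d =
      ((xA a b + (-2 * c - 2 * √(DeltaDelta a b c d)) / a ^ 2 : ℝ) : ℂ) := by
    rw [xDeltaMinus, hs]; push_cast; ring
  have ha2 : 0 < a ^ 2 := by positivity
  have key : (a ^ 2 * x + 2 * c) ^ 2 ≤ 4 * DeltaDelta a b c d ↔
      xA a b + (-2 * c - 2 * √(DeltaDelta a b c d)) / a ^ 2 ≤ xA a b + x ∧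
      xA a b + x ≤ xA a b + (-2 * c + 2 * √(DeltaDelta a b c d)) / a ^ 2 := by
    rw [add_le_add_iff_left, add_le_add_iff_left, div_le_iff₀ ha2, le_div_iff₀ ha2,
      show 4 * DeltaDelta a b c d = (2 * √(DeltaDelta a b c d)) ^ 2 by
        rw [mul_pow, Real.sq_sqrt hD]; norm_num, sq_le_sq,
      abs_of_nonneg (a := 2 * √_) (by positivity), abs_le]
    constructor <;> rintro ⟨h1, h2⟩ <;> constructor <;> linarith
  rw [JDelta, Set.mem_ofPred_eq, hp, hm, Complex.ofReal_re, Complex.ofReal_re, key]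
  constructor
  · rintro ⟨x', hx', h1, h2⟩
    have him := congrArg Complex.im hx'
    have hre := congrArg Complex.re hx'
    simp at him hre
    subst hre
    exact ⟨him, h1, h2⟩
  · rintro ⟨rfl, h⟩
    exact ⟨xA a b + x, by push_cast; simp, h⟩

theorem mem_affineSpan_vertical {m η : ℝ} (hη : η ≠ 0) {z : ℂ} :
    z ∈ affineSpan ℝ ({(m - η * Complex.I : ℂ), (m + η * Complex.I : ℂ)} : Set ℂ) ↔ z.re = m := by
  rw [mem_affineSpan_pair_iff_exists_lineMap_eq]
  constructor
  · rintro ⟨t, rfl⟩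
    simp [AffineMap.lineMap_apply]
  · intro h
    obtain ⟨t, ht⟩ : ∃ t : ℝ, η * (2 * t - 1) = z.im :=
      ⟨(z.im + η) / (2 * η), by field_simp; ring⟩
    refine ⟨t, Complex.ext ?_ ?_⟩
    · simp [AffineMap.lineMap_apply, h]
    · simp [AffineMap.lineMap_apply]
      linear_combination ht

/-- For `Δ_Δ < 0` the points `x_Δ^±` are complex conjugate, so the chord of the arc is vertical and
sides are read off real parts. -/
theorem wSameSide_vertical {m η : ℝ} (hη : η ≠ 0) {w z : ℂ} :
    (affineSpan ℝ ({(m - η * Complex.I : ℂ), (m + η * Complex.I : ℂ)} : Set ℂ)).WSameSide w z ↔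
      0 ≤ (w.re - m) * (z.re - m) := by
  constructor
  · rintro ⟨p, hp, q, hq, h⟩
    rw [mem_affineSpan_vertical hη] at hp hq
    have h' := h.map Complex.reLm
    simp only [vsub_eq_sub, Complex.reLm_coe, Complex.sub_re, hp, hq] at h'
    obtain h0 | h0 | ⟨r₁, r₂, h1, h2, h0⟩ := h'
    · simp [h0]
    · simp [h0]
    · simp only [smul_eq_mul] at h0
      have h3 : r₂ * ((w.re - m) * (z.re - m)) = r₁ * (w.re - m) ^ 2 := by
        linear_combination -(w.re - m) * h0
      have h4 : 0 ≤ r₁ * (w.re - m) ^ 2 := by positivity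
      rw [← h3] at h4
      exact nonneg_of_mul_nonneg_right h4 h2
  · intro h
    refine ⟨m + w.im * Complex.I, (mem_affineSpan_vertical hη).2 (by simp), m + z.im * Complex.I,
      (mem_affineSpan_vertical hη).2 (by simp), ?_⟩
    have e : ∀ v : ℂ, v -ᵥ (m + v.im * Complex.I) = (v.re - m) • (1 : ℂ) := by
      intro v
      apply Complex.ext <;> simp
    rw [e, e]
    rcases eq_or_ne (w.re - m) 0 with h0 | h0
    · rw [h0, zero_smul]; exact SameRay.zero_left _
    rcases eq_or_ne (z.re - m) 0 with h1 | h1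
    · rw [h1, zero_smul]; exact SameRay.zero_right _
    rcases mul_nonneg_iff.1 h with ⟨h2, h3⟩ | ⟨h2, h3⟩
    · exact (SameRay.sameRay_nonneg_smul_left _ h2).trans
        (SameRay.sameRay_nonneg_smul_right _ h3) (by simp)
    · rw [← neg_neg (w.re - m), ← neg_neg (z.re - m), neg_smul (-_), neg_smul (-(z.re - m)),
        sameRay_neg_iff]
      exact (SameRay.sameRay_nonneg_smul_left _ (by linarith)).trans
        (SameRay.sameRay_nonneg_smul_right _ (by linarith)) (by simp)

theorem dist_eq_iff_sq {u v : ℂ} {r : ℝ} (hr : 0 ≤ r) :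
    dist u v = r ↔ (u.re - v.re) ^ 2 + (u.im - v.im) ^ 2 = r ^ 2 := by
  rw [← sq_eq_sq₀ dist_nonneg hr, Complex.dist_eq, Complex.sq_norm, Complex.normSq_apply]
  simp [sq]

/-- The circle through `x_A` and the conjugate pair `x_Δ^±` is `C₀`: its centre is real by symmetry,
and equidistance from `x_A` puts it at `x_A - B(x_A) / c = x_B`. The chord lies at real part `x_A -
2 c / a ^ 2`, which gives the inequality. -/
theorem mem_circularArc_iff (ha : a ≠ 0) (hc : c ≠ 0) (hD : DeltaDelta a b c d < 0) (x y : ℝ) :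
    (xA a b + (x + y * Complex.I) : ℂ) ∈
      circularArc (xDeltaMinus a b c d) (xA a b : ℂ) (xDeltaPlus a b c d) ↔
    c * (x ^ 2 + y ^ 2) + 2 * x * BxA a b c d = 0 ∧ a ^ 2 * -(c * x) ≤ 2 * c ^ 2 := by
  have ha2 : 0 < a ^ 2 := by positivity
  set σ := √(-DeltaDelta a b c d) with hσ
  have hσ2 : σ ^ 2 = -DeltaDelta a b c d := Real.sq_sqrt (by linarith)
  have hσ0 : σ ≠ 0 := by rw [hσ, Real.sqrt_ne_zero']; linarith
  have hs : Complex.sqrt (DeltaDelta a b c d) = Complex.I * σ := by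
    have h1 : 0 ≤ -DeltaDelta a b c d := (neg_pos.2 hD).le
    have h2 := Complex.sqrt_neg_of_nonneg (a := ((-DeltaDelta a b c d : ℝ) : ℂ))
      (by exact_mod_cast h1)
    rw [Complex.sqrt_of_nonneg (a := ((-DeltaDelta a b c d : ℝ) : ℂ)) (by exact_mod_cast h1),
      Complex.ofReal_re, Complex.ofReal_neg,
      neg_neg] at h2
    exact h2
  set m := xA a b + -2 * c / a ^ 2 with hm
  set η := 2 * σ / a ^ 2 with hηdef
  have hη : η ≠ 0 := by simp [hηdef, hσ0, ha]
  have hp : xDeltaPlus a b c d = m + η * Complex.I := by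
    rw [xDeltaPlus, hs, hm, hηdef]; push_cast; ring
  have hn : xDeltaMinus a b c d = m - η * Complex.I := by
    rw [xDeltaMinus, hs, hm, hηdef]; push_cast; ring
  have hη2 : a ^ 4 * η ^ 2 = 4 * (a ^ 2 * BxA a b c d - c ^ 2) := by
    rw [hηdef, div_pow, mul_pow, hσ2, DeltaDelta]; field_simp; ring
  have hm2 : a ^ 2 * (m - xA a b) = -2 * c := by rw [hm]; field_simp; ring
  rw [circularArc, Set.mem_ofPred_eq, hp, hn, wSameSide_vertical hη]
  refine and_congr ?_ ?_
  · simp only [EuclideanGeometry.Cospherical, Set.mem_insert_iff, Set.mem_singleton_iff,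
      forall_eq_or_imp, forall_eq]
    constructor
    · rintro ⟨e, r, h1, h2, h3, h4⟩
      have hr : 0 ≤ r := h1 ▸ dist_nonneg
      rw [dist_eq_iff_sq hr] at h1 h2 h3 h4
      simp at h1 h2 h3 h4
      have he : e.im = 0 := by
        have : η * e.im = 0 := by linear_combination (h1 - h3) / 4
        exact (mul_eq_zero.1 this).resolve_left hη
      rw [he] at h1 h2 h3 h4
      have hmm : m = xA a b + (m - xA a b) := by ring
      generalize m - xA a b = μ at hm2 hmm
      rw [hmm] at h3
      have h5 : a ^ 4 * (μ ^ 2 + η ^ 2) = 2 * a ^ 4 * μ * (e.re - xA a b) := by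
        linear_combination a ^ 4 * (h3 - h2)
      have h6 : a ^ 2 * (BxA a b c d + c * (e.re - xA a b)) = 0 := by
        linear_combination h5 / 4 - hη2 / 4 +
          (-(a ^ 2 * μ) / 4 + c / 2 + a ^ 2 * (e.re - xA a b) / 2) * hm2
      have h7 := (mul_eq_zero.1 h6).resolve_left ha2.ne'
      linear_combination c * (h4 - h2) + 2 * x * h7
    · intro h
      refine ⟨((xA a b - BxA a b c d / c : ℝ) : ℂ), |BxA a b c d / c|, ?_⟩
      simp only [dist_eq_iff_sq (abs_nonneg _), sq_abs]
      have hme : m = xA a b + -2 * c / a ^ 2 := rfl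
      have hη2' : η ^ 2 = 4 * (a ^ 2 * BxA a b c d - c ^ 2) / a ^ 4 := by
        rw [← hη2]; field_simp
      simp
      rw [hη2', hme]
      refine ⟨?_, ?_⟩
      · field_simp
        ring
      · field_simp
        linear_combination c * h
  · simp
    have h1 : a ^ 4 * ((xA a b - m) * (xA a b + x - m)) = 2 * (a ^ 2 * (c * x) + 2 * c ^ 2) := by
      linear_combination (-a ^ 2 * (xA a b + x - m) - 2 * c) * hm2
    have ha4 : 0 < a ^ 4 := by positivity
    rw [← mul_nonneg_iff_of_pos_left ha4, h1]
    constructor <;> intro h <;> linarith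

theorem set_ext_of_forall_add {S T : Set ℂ} (u : ℂ)
    (H : ∀ x y : ℝ, u + (x + y * Complex.I) ∈ S ↔ u + (x + y * Complex.I) ∈ T) : S = T := by
  ext z
  have := H (z - u).re (z - u).im
  rwa [Complex.re_add_im, add_sub_cancel] at this

end LinRec

/-! ### The cases by signs of `Δ_Δ` and `B(x_A)` -/

theorem mainTheorem1 (a b c d : ℝ) (hac : a * c ≠ 0)
    (hnd : ¬ (a = 1 ∧ b + c = 0 ∧ d = 0)) :
    (∀ z : ℂ, LinRec.IsLimitOfZeros a b c d z →
      z ∈ LinRec.isolatedLimits a b c d ∨ z ∈ LinRec.nonIsolatedLimits a b c d) ∧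
    LinRec.isolatedLimits a b c d =
      {z : ℂ | LinRec.g a b c d z = 0 ∧
        (LinRec.A a b z * (starRingEnd ℂ) (LinRec.h a b z)).re < 0} ∧
    (LinRec.DeltaDelta a b c d < 0 →
      LinRec.nonIsolatedLimits a b c d =
        LinRec.circularArc (LinRec.xDeltaMinus a b c d) (LinRec.xA a b : ℂ)
          (LinRec.xDeltaPlus a b c d)) ∧
    (LinRec.DeltaDelta a b c d = 0 →
      LinRec.nonIsolatedLimits a b c d = LinRec.C0 a b c d) ∧
    (0 < LinRec.DeltaDelta a b c d → 0 < LinRec.BxA a b c d →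
      LinRec.nonIsolatedLimits a b c d = LinRec.JDelta a b c d ∪ LinRec.C0 a b c d) ∧
    (0 < LinRec.DeltaDelta a b c d → LinRec.BxA a b c d ≤ 0 →
      LinRec.nonIsolatedLimits a b c d = LinRec.JDelta a b c d) := by
  obtain ⟨ha, hc⟩ := mul_ne_zero_iff.1 hac
  have ha2 : 0 < a ^ 2 := by positivity
  have hc2 : 0 < c ^ 2 := by positivity
  have hDD : LinRec.DeltaDelta a b c d = c ^ 2 - a ^ 2 * LinRec.BxA a b c d := rfl
  -- points of the circle lie on the side of `x_A` where `c x ≤ 0` when `B(x_A) > 0`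
  have hcirc : ∀ x y : ℝ, 0 < LinRec.BxA a b c d →
      c * (x ^ 2 + y ^ 2) + 2 * x * LinRec.BxA a b c d = 0 →
      0 ≤ -(c * x) ∧ -(c * x) ≤ 2 * LinRec.BxA a b c d := by
    intro x y hβ h
    have h1 : c ^ 2 * (x ^ 2 + y ^ 2) = 2 * LinRec.BxA a b c d * -(c * x) := by
      linear_combination c * h
    have h2 : 0 ≤ -(c * x) :=
      nonneg_of_mul_nonneg_right (h1 ▸ by positivity) (by positivity : 0 < 2 * LinRec.BxA a b c d)
    refine ⟨h2, ?_⟩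
    by_contra hcon
    push Not at hcon
    have h3 : 0 < -(c * x) := by linarith
    nlinarith [mul_pos h3 (sub_pos.2 hcon), mul_nonneg hc2.le (sq_nonneg y)]
  refine ⟨fun z hz ↦ hz.isolated_or_nonIsolated, LinRec.isolatedLimits_eq ha hnd, fun hD ↦ ?_,
    fun hD ↦ ?_, fun hD hβ ↦ ?_, fun hD hβ ↦ ?_⟩
  · have hβ : 0 < LinRec.BxA a b c d := by
      by_contra hcon
      push Not at hcon
      nlinarith
    refine LinRec.set_ext_of_forall_add (LinRec.xA a b) fun x y ↦ ?_
    rw [LinRec.mem_nonIsolatedLimits_iff ha hc hnd, LinRec.mem_circularArc_iff ha hc hD]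
    constructor
    · rintro (⟨rfl, rfl | h⟩ | ⟨h1, -, h3⟩)
      · exact ⟨by simp, by simp; positivity⟩
      · linarith [sq_nonneg (a ^ 2 * x + 2 * c)]
      · exact ⟨h1, h3⟩
    · rintro ⟨h1, h3⟩
      exact Or.inr ⟨h1, (hcirc x y hβ h1).1, h3⟩
  · have hβ : 0 < LinRec.BxA a b c d := by
      by_contra hcon
      push Not at hcon
      nlinarith
    refine LinRec.set_ext_of_forall_add (LinRec.xA a b) fun x y ↦ ?_
    rw [LinRec.mem_nonIsolatedLimits_iff ha hc hnd, LinRec.mem_C0_iff hc]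
    constructor
    · rintro (⟨rfl, rfl | h⟩ | ⟨h1, -, -⟩)
      · simp
      -- For `Δ_Δ = 0` the interval shrinks to one point, the antipode of `x_A` on `C₀`.
      · have h0 : a ^ 2 * x + 2 * c = 0 := by
          rw [hD, mul_zero] at h
          exact pow_eq_zero_iff two_ne_zero |>.1 (le_antisymm h (sq_nonneg _))
        have : a ^ 2 * (c * (x ^ 2 + 0 ^ 2) + 2 * x * LinRec.BxA a b c d) = 0 := by
          rw [hD] at hDD
          linear_combination c * x * h0 + 2 * x * hDD
        exact (mul_eq_zero.1 this).resolve_left ha2.ne'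
      · exact h1
    · intro h1
      obtain ⟨h2, h3⟩ := hcirc x y hβ h1
      exact Or.inr ⟨h1, h2, by nlinarith⟩
  · refine LinRec.set_ext_of_forall_add (LinRec.xA a b) fun x y ↦ ?_
    rw [LinRec.mem_nonIsolatedLimits_iff ha hc hnd, Set.mem_union, LinRec.mem_C0_iff hc,
      LinRec.mem_JDelta_iff ha hD.le]
    constructor
    · rintro (⟨rfl, rfl | h⟩ | ⟨h1, -, -⟩)
      · exact Or.inr (by simp)
      · exact Or.inl ⟨rfl, h⟩
      · exact Or.inr h1
    · rintro (⟨rfl, h⟩ | h1)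
      · exact Or.inl ⟨rfl, Or.inr h⟩
      · obtain ⟨h2, h3⟩ := hcirc x y hβ h1
        -- `-(c x) ≤ 2 B(x_A)` and `a ^ 2 B(x_A) < c ^ 2`, so the half-plane contains the whole
        -- circle.
        exact Or.inr ⟨h1, h2, by nlinarith⟩
  · refine LinRec.set_ext_of_forall_add (LinRec.xA a b) fun x y ↦ ?_
    rw [LinRec.mem_nonIsolatedLimits_iff ha hc hnd, LinRec.mem_JDelta_iff ha hD.le]
    have h0 : (a ^ 2 * 0 + 2 * c) ^ 2 ≤ 4 * LinRec.DeltaDelta a b c d := by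
      rw [hDD]
      nlinarith
    constructor
    · rintro (⟨rfl, rfl | h⟩ | ⟨h1, h2, -⟩)
      · exact ⟨rfl, h0⟩
      · exact ⟨rfl, h⟩
      -- For `B(x_A) ≤ 0` the half-plane `c x ≤ 0` meets the circle only at `x_A`, which `h0` places
      -- in `J_Δ`.
      · have h4 : c ^ 2 * (x ^ 2 + y ^ 2) ≤ 0 := by
          have : c ^ 2 * (x ^ 2 + y ^ 2) = 2 * LinRec.BxA a b c d * -(c * x) := by
            linear_combination c * h1
          rw [this]
          exact mul_nonpos_of_nonpos_of_nonneg (by linarith) h2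
        have h5 : x ^ 2 + y ^ 2 ≤ 0 := nonpos_of_mul_nonpos_right h4 hc2
        have hx : x = 0 := pow_eq_zero_iff two_ne_zero |>.1 (by nlinarith [sq_nonneg x, sq_nonneg y])
        have hy : y = 0 := pow_eq_zero_iff two_ne_zero |>.1 (by nlinarith [sq_nonneg x, sq_nonneg y])
        exact ⟨hy, hx ▸ h0⟩
    · rintro ⟨rfl, h⟩
      exact Or.inl ⟨rfl, Or.inr h⟩
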